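/- Let $R$ be a (left and right) noetherian ring with identity, not necessarily commutative, and let $\sigma$ be an automorphism of $R$; "ideal" means two-sided ideal. An ideal $I$ of $R$ is called $\sigma$-semistable if $\sigma^n(I)=I$ for some integer $n\ge 1$, and $I^\circ$ denotes the largest ideal $J\subseteq I$ with $\sigma(J)=J$. For ideals $Q,P$ of $R$ we say that there is a link $Q\to P$ if there is an ideal $A$ of $R$ with $QP\subseteq A\subsetneq Q\cap P$ such that the bimodule $(Q\cap P)/A$ is torsionfree as a left $R/Q$-module and as a right $R/P$-module, i.e. no nonzero element of it is annihilated from the left by an element of $R$ that is regular modulo $Q$, or from the right by an element of $R$ that is regular modulo $P$ (an element is regular modulo an ideal $I$ if its image in $R/I$ is neither a left nor a right zero divisor). Theorem. Let $Q,P$ be $\sigma$-semistable prime ideals of $R$. If there is a link $Q^\circ\to P^\circ$, then for every integer $i\ge 0$ there is an integer $j\ge 0$ such that there is a link $\sigma^i(Q)\to\sigma^j(P)$. -/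

import Mathlib

namespace NoetherianLinks

/-- A two-sided ideal `P` of a (not necessarily commutative) ring is prime if it is proper and,
for all two-sided ideals `I`, `J`, the inclusion `I J ⊆ P` implies `I ⊆ P` or `J ⊆ P`.
(Since `P` is closed under addition, `I J ⊆ P` means `x y ∈ P` for all `x ∈ I`, `y ∈ J`.) -/
structure IsPrimeIdeal {R : Type*} [Ring R] (P : TwoSidedIdeal R) : Prop where
  ne_top : P ≠ ⊤
  le_or_le : ∀ I J : TwoSidedIdeal R, (∀ x ∈ I, ∀ y ∈ J, x * y ∈ P) → I ≤ P ∨ J ≤ P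

/-- The image `σ(I)` of a two-sided ideal under a ring automorphism. -/
def image {R : Type*} [Ring R] (σ : RingAut R) (I : TwoSidedIdeal R) : TwoSidedIdeal R :=
  RingEquiv.mapTwoSidedIdeal σ I

theorem coe_image {R : Type*} [Ring R] (σ : RingAut R) (I : TwoSidedIdeal R) :
    (image σ I : Set R) = σ '' (I : Set R) := by
  ext x
  simp only [image, RingEquiv.mapTwoSidedIdeal_apply, SetLike.mem_coe, TwoSidedIdeal.mem_comap,
    Set.mem_image]
  constructor
  · intro h
    exact ⟨_, h, RingEquiv.apply_symm_apply σ x⟩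
  · rintro ⟨y, hy, rfl⟩
    rwa [RingEquiv.symm_apply_apply]

/-- `I` is `σ`-invariant (`σ`-stable): `σ(I) = I`. -/
def IsInvariant {R : Type*} [Ring R] (σ : RingAut R) (I : TwoSidedIdeal R) : Prop :=
  image σ I = I

/-- `I` is `σ`-semistable: `σⁿ(I) = I` for some integer `n ≥ 1`. -/
def IsSemistable {R : Type*} [Ring R] (σ : RingAut R) (I : TwoSidedIdeal R) : Prop :=
  ∃ n : ℕ, 1 ≤ n ∧ image (σ ^ n) I = I

/-- The `σ`-invariant part `I°` of `I`: the largest `σ`-invariant ideal contained in `I`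
(see `isGreatest_invariantPart`). -/
def invariantPart {R : Type*} [Ring R] (σ : RingAut R) (I : TwoSidedIdeal R) : TwoSidedIdeal R :=
  sSup {J : TwoSidedIdeal R | IsInvariant σ J ∧ J ≤ I}

theorem isGreatest_invariantPart {R : Type*} [Ring R] (σ : RingAut R) (I : TwoSidedIdeal R) :
    IsGreatest {J : TwoSidedIdeal R | IsInvariant σ J ∧ J ≤ I} (invariantPart σ I) := by
  refine ⟨⟨?_, sSup_le fun J hJ => hJ.2⟩, fun J hJ => le_sSup hJ⟩
  show RingEquiv.mapTwoSidedIdeal σ (sSup _) = sSup _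
  rw [OrderIso.map_sSup, sSup_eq_iSup]
  exact iSup_congr fun J => iSup_congr fun hJ => hJ.1

/-- `c` is regular modulo the ideal `I`: its image in `R/I` is neither a left nor a right
zero divisor. -/
def IsRegularMod {R : Type*} [Ring R] (I : TwoSidedIdeal R) (c : R) : Prop :=
  ∀ r : R, (c * r ∈ I → r ∈ I) ∧ (r * c ∈ I → r ∈ I)

/-- There is a link `Q → P` via the ideal `A`: `Q P ⊆ A ⊊ Q ∩ P`, and the (nonzero) bimodule
`(Q ∩ P)/A` is torsionfree as a left `R/Q`-module and as a right `R/P`-module. A left (right)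
module over a ring is torsionfree if no nonzero element of it is annihilated by a regular element
of the ring; the condition `Q P ⊆ A` makes `(Q ∩ P)/A` a left `R/Q`- and a right `R/P`-module. -/
structure IsLinkVia {R : Type*} [Ring R] (Q P A : TwoSidedIdeal R) : Prop where
  mul_mem : ∀ x ∈ Q, ∀ y ∈ P, x * y ∈ A
  lt_inf : A < Q ⊓ P
  torsionfree_left : ∀ c : R, IsRegularMod Q c → ∀ x ∈ Q ⊓ P, c * x ∈ A → x ∈ A
  torsionfree_right : ∀ c : R, IsRegularMod P c → ∀ x ∈ Q ⊓ P, x * c ∈ A → x ∈ A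

/-- There is a link `Q → P`. -/
def IsLinked {R : Type*} [Ring R] (Q P : TwoSidedIdeal R) : Prop :=
  ∃ A : TwoSidedIdeal R, IsLinkVia Q P A

end NoetherianLinks

namespace NoetherianLinks

/-! `Q°` is the intersection of the finite `σ`-orbit of `Q`, and the members of the orbit are
pairwise incomparable primes; likewise for `P`. So it suffices to pass from a link between two such
finite intersections to a link between two of the primes, and then to apply a power of `σ`.

Let the given link be via `A`. For `q` in the first orbit let `N` be the intersection of its other
members; define `M` likewise for `p` in the second. The candidate for a link `q → p` is via the
ideal of all `x ∈ q ∩ p` with `N x M ⊆ A` (`sandwich`). Goldie theory supplies elements of `N`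
regular modulo `q`, and these sum over the orbit to an element regular modulo `Q°`. Torsionfreeness
over `R/Q°` and `R/P°` therefore makes the candidate proper for some pair `q`, `p`. The Ore
condition in `R/q` and `R/p` makes the quotient torsionfree for every pair. -/

/-- A left ideal is essential if it meets every nonzero left ideal. -/
def IsLeftEssential {S : Type*} [Ring S] (E : Ideal S) : Prop :=
  ∀ x : S, x ≠ 0 → ∃ r : S, r * x ≠ 0 ∧ r * x ∈ E

/-- The left ideal `{r | r * x ∈ E}`. -/
def leftColon {S : Type*} [Ring S] (E : Ideal S) (x : S) : Ideal S :=
  Submodule.comap (LinearMap.toSpanSingleton S S x) E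

/-- A ring is elementwise prime if `a S b = 0` forces `a = 0` or `b = 0`. -/
def IsPrimeRing (S : Type*) [Ring S] : Prop :=
  ∀ a b : S, (∀ s : S, a * s * b = 0) → a = 0 ∨ b = 0

/-! ### Goldie theory for prime noetherian rings. -/

section Goldie

variable {S : Type*} [Ring S]

theorem mem_leftColon {E : Ideal S} {x r : S} : r ∈ leftColon E x ↔ r * x ∈ E := by
  simp [leftColon]

theorem IsLeftEssential.mono {E F : Ideal S} (hE : IsLeftEssential E) (h : E ≤ F) :
    IsLeftEssential F := fun x hx => by
  obtain ⟨r, hr, hrE⟩ := hE x hx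
  exact ⟨r, hr, h hrE⟩

theorem IsLeftEssential.colon {E : Ideal S} (hE : IsLeftEssential E) (x : S) :
    IsLeftEssential (leftColon E x) := by
  intro y hy
  by_cases h : y * x = 0
  · exact ⟨1, by simpa using hy, by simp [mem_leftColon, h]⟩
  · obtain ⟨r, hr, hrE⟩ := hE _ h
    refine ⟨r, fun h0 => hr ?_, ?_⟩
    · rw [← mul_assoc, h0, zero_mul]
    · rwa [mem_leftColon, mul_assoc]

/-- A prime left noetherian ring is left nonsingular. -/
theorem eq_zero_of_isLeftEssential [IsNoetherianRing S] (hS : IsPrimeRing S) {x : S}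
    (hx : IsLeftEssential (leftColon ⊥ x)) : x = 0 := by
  by_contra hx0
  obtain ⟨K, ⟨z, hz0, hz, rfl⟩, hmax⟩ := set_has_maximal_iff_noetherian.2
    (inferInstance : IsNoetherian S S)
    {K : Ideal S | ∃ z : S, z ≠ 0 ∧ IsLeftEssential (leftColon ⊥ z) ∧ K = leftColon ⊥ z}
    ⟨_, x, hx0, hx, rfl⟩
  -- `z` is a nonzero singular element with maximal left annihilator. If `z s z ≠ 0`, its
  -- annihilator equals that of `z`; but the essential annihilator of `s z` contains some `r z ≠ 0`,
  -- so `r z s z = 0` forces `r z = 0`.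
  have key : ∀ s : S, z * s * z = 0 := by
    intro s
    by_contra h
    have hle : leftColon ⊥ z ≤ leftColon ⊥ (z * s * z) := fun r hr => by
      simp only [mem_leftColon, Submodule.mem_bot] at hr ⊢
      rw [mul_assoc z, ← mul_assoc r, hr, zero_mul]
    have hess : IsLeftEssential (leftColon ⊥ (s * z)) :=
      (hz.colon s).mono fun r hr => by
        simpa [mem_leftColon, mul_assoc] using hr
    obtain ⟨r, hr, hr'⟩ := hess z hz0
    refine hmax _ ⟨z * s * z, h, hz.mono hle, rfl⟩ (lt_of_le_of_ne hle fun heq => hr ?_)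
    have : r ∈ leftColon ⊥ z := by
      rw [heq]
      simpa [mem_leftColon, mul_assoc] using hr'
    simpa [mem_leftColon] using this
  rcases hS z z key with h | h <;> exact hz0 h

/-- In a left noetherian ring, an element with zero left annihilator generates an essential left
ideal. -/
theorem isLeftEssential_span_singleton [IsNoetherianRing S] {c : S}
    (hc : ∀ r : S, r * c = 0 → r = 0) : IsLeftEssential (Ideal.span {c}) := by
  intro x hx
  by_contra! h
  -- If `S c ∩ S x = 0`, then `S c ≅ S` and `S x` form a direct sum inside `S`, so the noetherian
  -- condition forces `S x = 0`.
  let f : S × (Ideal.span {x} : Ideal S) →ₗ[S] S :=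
    (LinearMap.toSpanSingleton S S c).coprod (Submodule.subtype _)
  have hf : Function.Injective f := by
    rw [injective_iff_map_eq_zero]
    rintro ⟨s, a, ha⟩ h0
    obtain ⟨r, rfl⟩ := Ideal.mem_span_singleton'.1 ha
    have h0 : s * c + r * x = 0 := by simpa [f] using h0
    have hrx : r * x = 0 := by
      by_contra hne
      refine h r hne (Ideal.mem_span_singleton'.2 ⟨-s, ?_⟩)
      rw [neg_mul, neg_eq_iff_add_eq_zero, h0]
    have hs : s = 0 := hc s (by simpa [hrx] using h0)
    ext <;> simp [hs, hrx]
  have := IsNoetherian.subsingleton_of_prod_injective f hf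
  exact hx (congrArg Subtype.val
    (Subsingleton.elim (⟨x, Ideal.mem_span_singleton_self x⟩ : (Ideal.span {x} : Ideal S)) 0))

/-- In a right noetherian ring, left annihilators of elements satisfy the minimum condition. -/
theorem exists_minimal_leftColon_bot [IsNoetherianRing Sᵐᵒᵖ] (E : Ideal S) :
    ∃ a ∈ E, ∀ b ∈ E, leftColon ⊥ b ≤ leftColon ⊥ a → leftColon ⊥ a ≤ leftColon ⊥ b := by
  -- Taking right annihilators reverses inclusions and loses nothing on left annihilators, so a
  -- maximal right annihilator yields a minimal left one.
  let rAnn : Ideal S → Ideal Sᵐᵒᵖ := fun L => ⨅ l ∈ L, leftColon ⊥ (MulOpposite.op l)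
  have mem_rAnn : ∀ (L : Ideal S) (x : S), MulOpposite.op x ∈ rAnn L ↔ ∀ l ∈ L, l * x = 0 := by
    intro L x
    simp [rAnn, Submodule.mem_iInf, mem_leftColon, ← MulOpposite.op_mul]
  obtain ⟨K, ⟨a, ha, rfl⟩, hmax⟩ := set_has_maximal_iff_noetherian.2
    (inferInstance : IsNoetherian Sᵐᵒᵖ Sᵐᵒᵖ)
    {K : Ideal Sᵐᵒᵖ | ∃ a ∈ E, K = rAnn (leftColon ⊥ a)} ⟨_, 0, E.zero_mem, rfl⟩
  refine ⟨a, ha, fun b hb hba r hr => ?_⟩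
  have hle : rAnn (leftColon ⊥ a) ≤ rAnn (leftColon ⊥ b) := fun x hx => by
    rw [← MulOpposite.op_unop x, mem_rAnn] at hx ⊢
    exact fun l hl => hx l (hba hl)
  have heq : rAnn (leftColon ⊥ a) = rAnn (leftColon ⊥ b) := by
    by_contra hne
    exact hmax _ ⟨b, hb, rfl⟩ (lt_of_le_of_ne hle hne)
  have hb' : MulOpposite.op b ∈ rAnn (leftColon ⊥ b) := (mem_rAnn _ _).2 fun l hl => by
    simpa [mem_leftColon] using hl
  rw [← heq, mem_rAnn] at hb'
  simpa [mem_leftColon] using hb' r hr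

/-- In a prime left noetherian ring, an element generating an essential left ideal has zero left
annihilator. -/
theorem eq_zero_of_mul_eq_zero_of_isLeftEssential_span [IsNoetherianRing S] (hS : IsPrimeRing S)
    {a : S} (ha : IsLeftEssential (Ideal.span {a})) {r : S} (hr : r * a = 0) : r = 0 := by
  have hpow : ∀ n : ℕ, IsLeftEssential (Ideal.span {a ^ n}) := by
    intro n
    induction n with
    | zero => exact fun x hx => ⟨1, by simpa using hx, by simp⟩
    | succ n ih =>
      intro x hx
      obtain ⟨r, hr0, hr⟩ := ha x hx
      obtain ⟨t, ht⟩ := Ideal.mem_span_singleton'.1 hr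
      have : ∃ s ∈ leftColon (Ideal.span {a ^ n}) t, s * (r * x) ≠ 0 := by
        by_contra! h
        exact hr0 (eq_zero_of_isLeftEssential hS ((ih.colon t).mono fun s hs => by
          simpa [mem_leftColon] using h s hs))
      obtain ⟨s, hs, hs0⟩ := this
      obtain ⟨y, hy⟩ := Ideal.mem_span_singleton'.1 (mem_leftColon.1 hs)
      refine ⟨s * r, by rwa [mul_assoc], Ideal.mem_span_singleton'.2 ⟨y, ?_⟩⟩
      rw [pow_succ, ← mul_assoc, hy, mul_assoc, ht, ← mul_assoc, mul_assoc]
  -- Fitting argument: some nonzero multiple `s r` equals `t a ^ n` with `n` past stabilization.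
  -- Then `t a ^ (n + 1) = s r a = 0` gives `t a ^ n = 0`.
  let F : ℕ →o Ideal S :=
    { toFun := fun n => leftColon ⊥ (a ^ n)
      monotone' := monotone_nat_of_le_succ fun n s hs => by
        simp only [mem_leftColon, Submodule.mem_bot] at hs ⊢
        rw [pow_succ, ← mul_assoc, hs, zero_mul] }
  obtain ⟨n, hn⟩ := monotone_stabilizes_iff_noetherian.2 (inferInstance : IsNoetherian S S) F
  by_contra hr0
  obtain ⟨s, hs0, hs⟩ := hpow n r hr0
  obtain ⟨t, ht⟩ := Ideal.mem_span_singleton'.1 hs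
  have h1 : t ∈ F (n + 1) := by
    change t ∈ leftColon ⊥ (a ^ (n + 1))
    rw [mem_leftColon, pow_succ, ← mul_assoc, ht, mul_assoc, hr, mul_zero]
    exact Submodule.zero_mem _
  rw [← hn (n + 1) n.le_succ] at h1
  exact hs0 (by simpa [F, mem_leftColon, ht] using h1)

/-- In a prime noetherian ring, an element with zero left annihilator is regular. -/
theorem eq_zero_of_mul_eq_zero_of_leftRegular [IsNoetherianRing S] (hS : IsPrimeRing S) {c : S}
    (hc : ∀ r : S, r * c = 0 → r = 0) {x : S} (hx : c * x = 0) : x = 0 :=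
  eq_zero_of_isLeftEssential hS <| (isLeftEssential_span_singleton hc).mono <| by
    intro r hr
    obtain ⟨t, rfl⟩ := Ideal.mem_span_singleton'.1 hr
    simp [mem_leftColon, mul_assoc, hx]

/-- **Goldie**: in a prime noetherian ring every essential left ideal contains a regular element. -/
theorem IsLeftEssential.exists_regular [IsNoetherianRing S] [IsNoetherianRing Sᵐᵒᵖ]
    (hS : IsPrimeRing S) {E : Ideal S} (hE : IsLeftEssential E) :
    ∃ c ∈ E, ∀ r : S, (c * r = 0 → r = 0) ∧ (r * c = 0 → r = 0) := by
  obtain ⟨a, ha, hmin⟩ := exists_minimal_leftColon_bot E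
  have hla : ∀ r : S, r * a = 0 → r = 0 := by
    intro k hk
    by_contra hk0
    refine hk0 (eq_zero_of_mul_eq_zero_of_isLeftEssential_span hS (fun x hx => ?_) hk)
    by_contra! h
    obtain ⟨t, ht0, ht⟩ := hE x hx
    -- `S a ∩ S x = 0`, so anything killing `a + s t x` kills `a`. Minimality gives the converse,
    -- and so `k` kills `s t x`.
    have key : ∀ s : S, k * s * (t * x) = 0 := by
      intro s
      have hle : leftColon ⊥ (a + s * (t * x)) ≤ leftColon ⊥ a := fun r hr => by
        simp only [mem_leftColon, Submodule.mem_bot, mul_add] at hr ⊢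
        by_contra hra
        refine h (r * s * t) (fun h0 => hra ?_) (Ideal.mem_span_singleton'.2 ⟨-r, ?_⟩)
        · simpa [← mul_assoc, h0] using hr
        · rw [neg_mul, neg_eq_iff_add_eq_zero, ← hr]
          simp only [mul_assoc]
      have := hmin _ (E.add_mem ha (E.mul_mem_left s ht)) hle
        (show k ∈ leftColon ⊥ a by simpa [mem_leftColon] using hk)
      simpa [mem_leftColon, mul_add, hk, mul_assoc] using this
    rcases hS k (t * x) key with h' | h'
    · exact hk0 h'
    · exact ht0 h'
  exact ⟨a, ha, fun r => ⟨eq_zero_of_mul_eq_zero_of_leftRegular hS hla, hla r⟩⟩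

/-- The left Ore condition for the regular elements of a prime noetherian ring. -/
theorem exists_regular_mul_eq_mul [IsNoetherianRing S] [IsNoetherianRing Sᵐᵒᵖ]
    (hS : IsPrimeRing S) {c : S} (hc : ∀ r : S, r * c = 0 → r = 0) (n : S) :
    ∃ d t : S, (∀ r : S, (d * r = 0 → r = 0) ∧ (r * d = 0 → r = 0)) ∧ d * n = t * c := by
  obtain ⟨d, hd, hreg⟩ := ((isLeftEssential_span_singleton hc).colon n).exists_regular hS
  obtain ⟨t, ht⟩ := Ideal.mem_span_singleton'.1 (mem_leftColon.1 hd)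
  exact ⟨d, t, hreg, ht.symm⟩

theorem IsPrimeRing.op (hS : IsPrimeRing S) : IsPrimeRing Sᵐᵒᵖ := by
  intro a b h
  rcases hS b.unop a.unop fun s => by
    simpa [mul_assoc] using congrArg MulOpposite.unop (h (MulOpposite.op s)) with h | h
  · exact .inr (by simpa using h)
  · exact .inl (by simpa using h)

/-- The right Ore condition for the regular elements of a prime noetherian ring. -/
theorem exists_mul_regular_eq_mul [IsNoetherianRing S] [IsNoetherianRing Sᵐᵒᵖ]
    (hS : IsPrimeRing S) {c : S} (hc : ∀ r : S, c * r = 0 → r = 0) (n : S) :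
    ∃ d t : S, (∀ r : S, (d * r = 0 → r = 0) ∧ (r * d = 0 → r = 0)) ∧ n * d = c * t := by
  have : IsNoetherianRing Sᵐᵒᵖᵐᵒᵖ := isNoetherianRing_of_ringEquiv S (RingEquiv.opOp S)
  obtain ⟨d, t, hd, h⟩ := exists_regular_mul_eq_mul hS.op (c := MulOpposite.op c)
    (fun r hr => by
      simpa using hc r.unop (by simpa using congrArg MulOpposite.unop hr)) (MulOpposite.op n)
  refine ⟨d.unop, t.unop, fun r => ⟨fun hr => ?_, fun hr => ?_⟩, ?_⟩
  · simpa using (hd (MulOpposite.op r)).2 (MulOpposite.unop_injective (by simpa using hr))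
  · simpa using (hd (MulOpposite.op r)).1 (MulOpposite.unop_injective (by simpa using hr))
  · simpa using congrArg MulOpposite.unop h

end Goldie

/-! ### Prime ideals and regular elements modulo them. -/

section Prime

variable {R : Type*} [Ring R]

/-- Both `J = {y | a R y ⊆ Q}` and `I = {x | x J ⊆ Q}` are two-sided ideals, with `I J ⊆ Q`, `a ∈ I`
and `b ∈ J`. -/
theorem IsPrimeIdeal.mem_or_mem {Q : TwoSidedIdeal R} (hQ : IsPrimeIdeal Q) {a b : R}
    (h : ∀ s : R, a * s * b ∈ Q) : a ∈ Q ∨ b ∈ Q := by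
  let J : TwoSidedIdeal R := TwoSidedIdeal.mk' {y | ∀ s : R, a * s * y ∈ Q}
    (fun s => by simp [Q.zero_mem])
    (fun hx hy s => by rw [mul_add]; exact Q.add_mem (hx s) (hy s))
    (fun hx s => by rw [mul_neg]; exact Q.neg_mem (hx s))
    (fun {x y} hy s => by simpa only [mul_assoc] using hy (s * x))
    (fun hx s => by rw [← mul_assoc]; exact Q.mul_mem_right _ _ (hx s))
  have hJ : ∀ y, y ∈ J ↔ ∀ s : R, a * s * y ∈ Q := fun y => TwoSidedIdeal.mem_mk' ..
  let I : TwoSidedIdeal R := TwoSidedIdeal.mk' {x | ∀ y ∈ J, x * y ∈ Q}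
    (fun y _ => by rw [zero_mul]; exact Q.zero_mem)
    (fun hx hy s hs => by rw [add_mul]; exact Q.add_mem (hx s hs) (hy s hs))
    (fun hx s hs => by rw [neg_mul]; exact Q.neg_mem (hx s hs))
    (fun hy s hs => by rw [mul_assoc]; exact Q.mul_mem_left _ _ (hy s hs))
    (fun {x y} hx s hs => by rw [mul_assoc]; exact hx _ (J.mul_mem_left _ _ hs))
  have hI : ∀ x, x ∈ I ↔ ∀ y ∈ J, x * y ∈ Q := fun x => TwoSidedIdeal.mem_mk' ..
  rcases hQ.le_or_le I J fun x hx y hy => (hI x).1 hx y hy with h' | h'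
  · exact .inl (h' ((hI a).2 fun y hy => by simpa using (hJ y).1 hy 1))
  · exact .inr (h' ((hJ b).2 h))

theorem mk_eq_zero_iff (Q : TwoSidedIdeal R) (x : R) : Q.ringCon.mk' x = 0 ↔ x ∈ Q :=
  RingCon.eq Q.ringCon

theorem IsPrimeIdeal.isPrimeRing {Q : TwoSidedIdeal R} (hQ : IsPrimeIdeal Q) :
    IsPrimeRing Q.ringCon.Quotient := by
  intro a b h
  obtain ⟨a, rfl⟩ := Q.ringCon.mk'_surjective a
  obtain ⟨b, rfl⟩ := Q.ringCon.mk'_surjective b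
  simp only [mk_eq_zero_iff]
  refine hQ.mem_or_mem fun s => ?_
  rw [← mk_eq_zero_iff, map_mul, map_mul]
  exact h _

theorem isRegularMod_iff {Q : TwoSidedIdeal R} {c : R} : IsRegularMod Q c ↔
    ∀ r : Q.ringCon.Quotient, (Q.ringCon.mk' c * r = 0 → r = 0) ∧
      (r * Q.ringCon.mk' c = 0 → r = 0) := by
  simp only [Q.ringCon.mk'_surjective.forall, ← map_mul, mk_eq_zero_iff]
  rfl

theorem IsRegularMod.mul {Q : TwoSidedIdeal R} {c d : R} (hc : IsRegularMod Q c)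
    (hd : IsRegularMod Q d) : IsRegularMod Q (c * d) := fun r =>
  ⟨fun h => (hd r).1 ((hc _).1 (by rwa [← mul_assoc])),
    fun h => (hc r).2 ((hd _).2 (by rwa [mul_assoc]))⟩

theorem IsRegularMod.of_sub_mem {Q : TwoSidedIdeal R} {c d : R} (hc : IsRegularMod Q c)
    (h : d - c ∈ Q) : IsRegularMod Q d := fun r =>
  ⟨fun hr => (hc r).1 (by
      have := Q.sub_mem hr (Q.mul_mem_right _ r h)
      rwa [sub_mul, sub_sub_cancel] at this),
    fun hr => (hc r).2 (by
      have := Q.sub_mem hr (Q.mul_mem_left r _ h)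
      rwa [mul_sub, sub_sub_cancel] at this)⟩

theorem isNoetherianRing_quotient [IsNoetherianRing R] (Q : TwoSidedIdeal R) :
    IsNoetherianRing Q.ringCon.Quotient :=
  isNoetherianRing_of_surjective R _ Q.ringCon.mk' Q.ringCon.mk'_surjective

theorem isNoetherianRing_quotient_op [IsNoetherianRing Rᵐᵒᵖ] (Q : TwoSidedIdeal R) :
    IsNoetherianRing (Q.ringCon.Quotient)ᵐᵒᵖ :=
  isNoetherianRing_of_surjective Rᵐᵒᵖ _ (RingHom.op Q.ringCon.mk') fun y => by
    obtain ⟨x, hx⟩ := Q.ringCon.mk'_surjective y.unop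
    exact ⟨MulOpposite.op x, MulOpposite.unop_injective (by simpa using hx)⟩

variable [IsNoetherianRing R] [IsNoetherianRing Rᵐᵒᵖ]

/-- An ideal not contained in a prime ideal `Q` contains an element regular modulo `Q`. -/
theorem IsPrimeIdeal.exists_isRegularMod_mem {Q : TwoSidedIdeal R} (hQ : IsPrimeIdeal Q)
    {I : TwoSidedIdeal R} (hI : ¬ I ≤ Q) : ∃ u ∈ I, IsRegularMod Q u := by
  have := isNoetherianRing_quotient Q
  have := isNoetherianRing_quotient_op Q
  obtain ⟨i, hiI, hiQ⟩ := SetLike.not_le_iff_exists.1 hI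
  -- In a prime ring every nonzero two-sided ideal is left essential.
  have hE : IsLeftEssential (Ideal.map Q.ringCon.mk' I.asIdeal) := by
    intro y hy
    obtain ⟨x, rfl⟩ := Q.ringCon.mk'_surjective y
    rw [Ne, mk_eq_zero_iff] at hy
    have : ∃ s, i * s * x ∉ Q := by
      by_contra! h
      exact (hQ.mem_or_mem h).elim hiQ hy
    obtain ⟨s, hs⟩ := this
    refine ⟨Q.ringCon.mk' (i * s), ?_, ?_⟩
    · rwa [← map_mul, Ne, mk_eq_zero_iff]
    · rw [← map_mul]
      exact Ideal.mem_map_of_mem _ (TwoSidedIdeal.mem_asIdeal.2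
        (I.mul_mem_right _ _ (I.mul_mem_right _ _ hiI)))
  obtain ⟨c, hc, hreg⟩ := hE.exists_regular hQ.isPrimeRing
  obtain ⟨u, hu, rfl⟩ := (Ideal.mem_map_iff_of_surjective _ Q.ringCon.mk'_surjective).1 hc
  exact ⟨u, TwoSidedIdeal.mem_asIdeal.1 hu, isRegularMod_iff.2 hreg⟩

theorem IsPrimeIdeal.exists_left_ore {Q : TwoSidedIdeal R} (hQ : IsPrimeIdeal Q) {c : R}
    (hc : IsRegularMod Q c) (n : R) :
    ∃ d t : R, IsRegularMod Q d ∧ d * n - t * c ∈ Q := by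
  have := isNoetherianRing_quotient Q
  have := isNoetherianRing_quotient_op Q
  obtain ⟨d, t, hd, h⟩ := exists_regular_mul_eq_mul hQ.isPrimeRing
    (fun r => (isRegularMod_iff.1 hc r).2) (Q.ringCon.mk' n)
  obtain ⟨d, rfl⟩ := Q.ringCon.mk'_surjective d
  obtain ⟨t, rfl⟩ := Q.ringCon.mk'_surjective t
  refine ⟨d, t, isRegularMod_iff.2 hd, ?_⟩
  rw [← mk_eq_zero_iff, map_sub, map_mul, map_mul, h, sub_self]

theorem IsPrimeIdeal.exists_right_ore {Q : TwoSidedIdeal R} (hQ : IsPrimeIdeal Q) {c : R}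
    (hc : IsRegularMod Q c) (n : R) :
    ∃ d t : R, IsRegularMod Q d ∧ n * d - c * t ∈ Q := by
  have := isNoetherianRing_quotient Q
  have := isNoetherianRing_quotient_op Q
  obtain ⟨d, t, hd, h⟩ := exists_mul_regular_eq_mul hQ.isPrimeRing
    (fun r => (isRegularMod_iff.1 hc r).1) (Q.ringCon.mk' n)
  obtain ⟨d, rfl⟩ := Q.ringCon.mk'_surjective d
  obtain ⟨t, rfl⟩ := Q.ringCon.mk'_surjective t
  refine ⟨d, t, isRegularMod_iff.2 hd, ?_⟩
  rw [← mk_eq_zero_iff, map_sub, map_mul, map_mul, h, sub_self]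

end Prime

/-! ### Finite intersections of incomparable primes. -/

section Semiprime

variable {R : Type*} [Ring R]

theorem mem_finsetInf {s : Finset (TwoSidedIdeal R)} {x : R} :
    x ∈ s.inf id ↔ ∀ q ∈ s, x ∈ q := by
  classical
  induction s using Finset.induction_on with
  | empty => simp [TwoSidedIdeal.mem_top]
  | insert q s _ ih =>
    rw [Finset.inf_insert, TwoSidedIdeal.mem_inf, ih, id, Finset.forall_mem_insert]

open Classical in
/-- The intersection of the members of `s` other than `q`. -/
noncomputable def otherInf (s : Finset (TwoSidedIdeal R)) (q : TwoSidedIdeal R) :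
    TwoSidedIdeal R :=
  (s.erase q).inf id

theorem mem_otherInf {s : Finset (TwoSidedIdeal R)} {q : TwoSidedIdeal R} {x : R} :
    x ∈ otherInf s q ↔ ∀ q' ∈ s, q' ≠ q → x ∈ q' := by
  classical
  rw [otherInf, mem_finsetInf]
  simp only [Finset.mem_erase]
  exact ⟨fun h q' hs hne => h q' ⟨hne, hs⟩, fun h q' hq' => h q' hq'.2 hq'.1⟩

theorem mem_finsetInf_of_mem_otherInf {s : Finset (TwoSidedIdeal R)} {q : TwoSidedIdeal R} {x : R}
    (hx : x ∈ otherInf s q) (hxq : x ∈ q) : x ∈ s.inf id :=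
  mem_finsetInf.2 fun q' hq' => by
    by_cases h : q' = q
    · rwa [h]
    · exact mem_otherInf.1 hx q' hq' h

/-- In a prime ideal containing a finite intersection of ideals, one of these is contained. -/
theorem IsPrimeIdeal.exists_le_of_finsetInf_le {Q : TwoSidedIdeal R} (hQ : IsPrimeIdeal Q)
    (s : Finset (TwoSidedIdeal R)) (h : s.inf id ≤ Q) : ∃ q ∈ s, q ≤ Q := by
  classical
  induction s using Finset.induction_on with
  | empty => exact (hQ.ne_top (top_le_iff.1 (by simpa using h))).elim
  | insert a s _ ih =>
    rw [Finset.inf_insert, id] at h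
    rcases hQ.le_or_le a (s.inf id) fun x hx y hy => h ((TwoSidedIdeal.mem_inf R).2
      ⟨TwoSidedIdeal.mul_mem_right _ _ _ hx, TwoSidedIdeal.mul_mem_left _ _ _ hy⟩) with h' | h'
    · exact ⟨a, Finset.mem_insert_self _ _, h'⟩
    · obtain ⟨q, hq, hqQ⟩ := ih h'
      exact ⟨q, Finset.mem_insert_of_mem hq, hqQ⟩

theorem isRegularMod_finsetInf {s : Finset (TwoSidedIdeal R)} {c : R}
    (h : ∀ q ∈ s, IsRegularMod q c) : IsRegularMod (s.inf id) c := fun r => by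
  simp only [mem_finsetInf]
  exact ⟨fun hr q hq => (h q hq r).1 (hr q hq), fun hr q hq => (h q hq r).2 (hr q hq)⟩

/-- Elements that are regular modulo one ideal of `s` each, and lie in all others, add up to an
element that is regular modulo the intersection. -/
theorem isRegularMod_sum {s : Finset (TwoSidedIdeal R)} {w : TwoSidedIdeal R → R}
    (hw : ∀ q ∈ s, IsRegularMod q (w q)) (hw' : ∀ q ∈ s, w q ∈ otherInf s q) :
    IsRegularMod (s.inf id) (∑ q ∈ s, w q) := by
  classical
  refine isRegularMod_finsetInf fun q hq => (hw q hq).of_sub_mem ?_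
  -- Modulo `q` only the summand `w q` survives.
  rw [← Finset.sum_erase_eq_sub hq]
  refine sum_mem fun q' hq' => ?_
  exact mem_otherInf.1 (hw' q' (Finset.mem_of_mem_erase hq')) q hq (Finset.ne_of_mem_erase hq').symm

/-- A finite set of pairwise incomparable prime ideals. -/
structure IsPrimeAntichain (s : Finset (TwoSidedIdeal R)) : Prop where
  isPrimeIdeal : ∀ q ∈ s, IsPrimeIdeal q
  eq_of_le : ∀ q ∈ s, ∀ q' ∈ s, q ≤ q' → q = q'

/-- The ideal of all `x ∈ q ∩ p` with `N x M ⊆ A`. -/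
def sandwich (q p N M A : TwoSidedIdeal R) : TwoSidedIdeal R :=
  TwoSidedIdeal.mk' {x | x ∈ q ⊓ p ∧ ∀ n ∈ N, ∀ m ∈ M, n * x * m ∈ A}
    ⟨TwoSidedIdeal.zero_mem _, fun n _ m _ => by simp [A.zero_mem]⟩
    (fun hx hy => ⟨TwoSidedIdeal.add_mem _ hx.1 hy.1, fun n hn m hm => by
      rw [mul_add, add_mul]; exact A.add_mem (hx.2 n hn m hm) (hy.2 n hn m hm)⟩)
    (fun hx => ⟨TwoSidedIdeal.neg_mem _ hx.1, fun n hn m hm => by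
      rw [mul_neg, neg_mul]; exact A.neg_mem (hx.2 n hn m hm)⟩)
    (fun hx => ⟨TwoSidedIdeal.mul_mem_left _ _ _ hx.1, fun n hn m hm => by
      rw [← mul_assoc]; exact hx.2 _ (N.mul_mem_right _ _ hn) m hm⟩)
    (fun hx => ⟨TwoSidedIdeal.mul_mem_right _ _ _ hx.1, fun n hn m hm => by
      rw [← mul_assoc, mul_assoc]; exact hx.2 n hn _ (M.mul_mem_left _ _ hm)⟩)

theorem mem_sandwich {q p N M A : TwoSidedIdeal R} {x : R} :
    x ∈ sandwich q p N M A ↔ x ∈ q ⊓ p ∧ ∀ n ∈ N, ∀ m ∈ M, n * x * m ∈ A :=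
  TwoSidedIdeal.mem_mk' ..

variable [IsNoetherianRing R] [IsNoetherianRing Rᵐᵒᵖ]

/-- By primeness and incomparability, `otherInf s q` is not contained in `q`, so it contains an
element regular modulo `q`. -/
theorem IsPrimeAntichain.exists_isRegularMod {s : Finset (TwoSidedIdeal R)}
    (hs : IsPrimeAntichain s) :
    ∃ w : TwoSidedIdeal R → R, ∀ q ∈ s, w q ∈ otherInf s q ∧ IsRegularMod q (w q) := by
  classical
  have : ∀ q, ∃ u, q ∈ s → u ∈ otherInf s q ∧ IsRegularMod q u := fun q => by
    by_cases hq : q ∈ s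
    · obtain ⟨u, hu⟩ := (hs.isPrimeIdeal q hq).exists_isRegularMod_mem
        (I := otherInf s q) fun h => by
          obtain ⟨q', hq', hle⟩ := (hs.isPrimeIdeal q hq).exists_le_of_finsetInf_le _ h
          exact Finset.ne_of_mem_erase hq'
            (hs.eq_of_le q' (Finset.mem_of_mem_erase hq') q hq hle)
      exact ⟨u, fun _ => hu⟩
    · exact ⟨0, fun h => (hq h).elim⟩
  choose w hw using this
  exact ⟨w, hw⟩

/-- An element of `otherInf s q` that is regular modulo `q` can be completed by an element of `q` to
one that is regular modulo the intersection of `s`. -/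
theorem IsPrimeAntichain.exists_isRegularMod_add {s : Finset (TwoSidedIdeal R)}
    (hs : IsPrimeAntichain s) {q : TwoSidedIdeal R} (hq : q ∈ s) {u : R}
    (hu : u ∈ otherInf s q) (hreg : IsRegularMod q u) :
    ∃ v ∈ q, IsRegularMod (s.inf id) (u + v) := by
  classical
  obtain ⟨w, hw⟩ := hs.exists_isRegularMod
  refine ⟨∑ q' ∈ s.erase q, w q', sum_mem fun q' hq' => ?_, ?_⟩
  · exact mem_otherInf.1 (hw q' (Finset.mem_of_mem_erase hq')).1 q hq
      (Finset.ne_of_mem_erase hq').symm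
  · have hw1 : ∀ q' ∈ s, Function.update w q u q' ∈ otherInf s q' ∧
        IsRegularMod q' (Function.update w q u q') := fun q' hq' => by
      by_cases h : q' = q
      · subst h
        simpa using ⟨hu, hreg⟩
      · simpa [h] using hw q' hq'
    have := isRegularMod_sum (fun q' hq' => (hw1 q' hq').2) fun q' hq' => (hw1 q' hq').1
    rw [← Finset.add_sum_erase s _ hq, Function.update_self] at this
    rwa [← Finset.sum_congr rfl fun q' hq' =>
      Function.update_of_ne (Finset.ne_of_mem_erase hq') u w]

end Semiprime
-- From a link of intersections to a link of primes.
section Link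

variable {R : Type*} [Ring R] [IsNoetherianRing R] [IsNoetherianRing Rᵐᵒᵖ]
  {s t : Finset (TwoSidedIdeal R)} {q p A : TwoSidedIdeal R}

/-- For `n ∈ otherInf s q`, `x ∈ q ∩ p` and `m ∈ otherInf t p`, the element `n x m` lies in the
intersection of `s` and of `t`. -/
theorem mul_mul_mem_inf {R : Type*} [Ring R] {s t : Finset (TwoSidedIdeal R)}
    {q p : TwoSidedIdeal R} {n x m : R}
    (hn : n ∈ otherInf s q) (hx : x ∈ q ⊓ p) (hm : m ∈ otherInf t p) :
    n * x * m ∈ s.inf id ⊓ t.inf id := by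
  rw [TwoSidedIdeal.mem_inf] at hx ⊢
  refine ⟨TwoSidedIdeal.mul_mem_right _ _ _ (mem_finsetInf_of_mem_otherInf (q := q) ?_ ?_), ?_⟩
  · exact TwoSidedIdeal.mul_mem_right _ _ _ hn
  · exact TwoSidedIdeal.mul_mem_left _ _ _ hx.1
  · rw [mul_assoc]
    exact TwoSidedIdeal.mul_mem_left _ _ _ (mem_finsetInf_of_mem_otherInf (q := p)
      (TwoSidedIdeal.mul_mem_left _ _ _ hm) (TwoSidedIdeal.mul_mem_right _ _ _ hx.2))

/-- The Ore condition gives `d n ≡ r c` modulo `q`. Multiplying by `w q ∈ N` turns this into a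
congruence modulo the intersection of `s`, whose product with `x m` falls in `A`; hence `w q d n x m
∈ A`. Adding `v` makes the multiplier regular, at no cost since `v n` also lies in that
intersection. -/
theorem IsLinkVia.sandwich_torsionfree_left (hs : IsPrimeAntichain s) (hq : q ∈ s)
    (h : IsLinkVia (s.inf id) (t.inf id) A) {c x : R} (hc : IsRegularMod q c) (hx : x ∈ q ⊓ p)
    (hcx : c * x ∈ sandwich q p (otherInf s q) (otherInf t p) A) :
    x ∈ sandwich q p (otherInf s q) (otherInf t p) A := by
  refine mem_sandwich.2 ⟨hx, fun n hn m hm => ?_⟩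
  have hxp := ((TwoSidedIdeal.mem_inf R).1 hx).2
  obtain ⟨d, r, hd, hdr⟩ := (hs.isPrimeIdeal q hq).exists_left_ore hc n
  obtain ⟨w, hw⟩ := hs.exists_isRegularMod
  obtain ⟨hu, hureg⟩ := hw q hq
  obtain ⟨v, hv, hreg⟩ := hs.exists_isRegularMod_add hq
    (TwoSidedIdeal.mul_mem_right _ _ d hu) (hureg.mul hd)
  have hxm : x * m ∈ t.inf id := mem_finsetInf_of_mem_otherInf
    (TwoSidedIdeal.mul_mem_left _ _ _ hm) (TwoSidedIdeal.mul_mem_right _ _ _ hxp)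
  refine h.torsionfree_left _ hreg _ (mul_mul_mem_inf hn hx hm) ?_
  have h1 : w q * (d * n - r * c) * (x * m) ∈ A := h.mul_mem _
    (mem_finsetInf_of_mem_otherInf (TwoSidedIdeal.mul_mem_right _ _ _ hu)
      (TwoSidedIdeal.mul_mem_left _ _ _ hdr)) _ hxm
  have h2 : w q * r * (c * x) * m ∈ A :=
    (mem_sandwich.1 hcx).2 _ (TwoSidedIdeal.mul_mem_right _ _ _ hu) _ hm
  have h3 : v * n * (x * m) ∈ A := h.mul_mem _
    (mem_finsetInf_of_mem_otherInf (TwoSidedIdeal.mul_mem_left _ _ _ hn)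
      (TwoSidedIdeal.mul_mem_right _ _ _ hv)) _ hxm
  have heq : (w q * d + v) * (n * x * m) =
      w q * (d * n - r * c) * (x * m) + w q * r * (c * x) * m + v * n * (x * m) := by
    noncomm_ring
  rw [heq]
  exact A.add_mem (A.add_mem h1 h2) h3

/-- Mirror image of the left case, with the right Ore condition modulo `p`. -/
theorem IsLinkVia.sandwich_torsionfree_right (ht : IsPrimeAntichain t) (hp : p ∈ t)
    (h : IsLinkVia (s.inf id) (t.inf id) A) {c x : R} (hc : IsRegularMod p c) (hx : x ∈ q ⊓ p)
    (hxc : x * c ∈ sandwich q p (otherInf s q) (otherInf t p) A) :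
    x ∈ sandwich q p (otherInf s q) (otherInf t p) A := by
  refine mem_sandwich.2 ⟨hx, fun n hn m hm => ?_⟩
  have hxq := ((TwoSidedIdeal.mem_inf R).1 hx).1
  obtain ⟨d, r, hd, hdr⟩ := (ht.isPrimeIdeal p hp).exists_right_ore hc m
  obtain ⟨w, hw⟩ := ht.exists_isRegularMod
  obtain ⟨hu, hureg⟩ := hw p hp
  obtain ⟨v, hv, hreg⟩ := ht.exists_isRegularMod_add hp
    (TwoSidedIdeal.mul_mem_left _ d _ hu) (hd.mul hureg)
  have hnx : n * x ∈ s.inf id := mem_finsetInf_of_mem_otherInf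
    (TwoSidedIdeal.mul_mem_right _ _ _ hn) (TwoSidedIdeal.mul_mem_left _ _ _ hxq)
  refine h.torsionfree_right _ hreg _ (mul_mul_mem_inf hn hx hm) ?_
  have h1 : n * x * ((m * d - c * r) * w p) ∈ A := h.mul_mem _ hnx _
    (mem_finsetInf_of_mem_otherInf (TwoSidedIdeal.mul_mem_left _ _ _ hu)
      (TwoSidedIdeal.mul_mem_right _ _ _ hdr))
  have h2 : n * (x * c) * (r * w p) ∈ A :=
    (mem_sandwich.1 hxc).2 _ hn _ (TwoSidedIdeal.mul_mem_left _ _ _ hu)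
  have h3 : n * x * (m * v) ∈ A := h.mul_mem _ hnx _
    (mem_finsetInf_of_mem_otherInf (TwoSidedIdeal.mul_mem_right _ _ _ hm)
      (TwoSidedIdeal.mul_mem_left _ _ _ hv))
  have heq : n * x * m * (d * w p + v) =
      n * x * ((m * d - c * r) * w p) + n * (x * c) * (r * w p) + n * x * (m * v) := by
    noncomm_ring
  rw [heq]
  exact A.add_mem (A.add_mem h1 h2) h3

/-- A link between two finite intersections of incomparable prime ideals induces a link between two
of these prime ideals. -/
theorem IsLinked.exists_isLinked_of_finsetInf (hs : IsPrimeAntichain s) (ht : IsPrimeAntichain t)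
    (h : IsLinked (s.inf id) (t.inf id)) : ∃ q ∈ s, ∃ p ∈ t, IsLinked q p := by
  obtain ⟨A, h⟩ := h
  obtain ⟨b, hb, hbA⟩ := SetLike.exists_of_lt h.lt_inf
  obtain ⟨u, hu⟩ := hs.exists_isRegularMod
  obtain ⟨w, hw⟩ := ht.exists_isRegularMod
  have hex : ∃ q ∈ s, ∃ p ∈ t, u q * b * w p ∉ A := by
    -- Otherwise `(∑ u q) b (∑ w p) ∈ A`, and both regular factors can be cancelled, giving `b ∈ A`.
    by_contra! hcon
    refine hbA (h.torsionfree_left _ (isRegularMod_sum (fun q hq => (hu q hq).2)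
      fun q hq => (hu q hq).1) _ hb (h.torsionfree_right _ (isRegularMod_sum
        (fun p hp => (hw p hp).2) fun p hp => (hw p hp).1) _
          (TwoSidedIdeal.mul_mem_left _ _ _ hb) ?_))
    rw [Finset.sum_mul, Finset.sum_mul_sum]
    exact sum_mem fun q hq => sum_mem fun p hp => hcon q hq p hp
  obtain ⟨q, hq, p, hp, hqp⟩ := hex
  have hb' := (TwoSidedIdeal.mem_inf R).1 hb
  refine ⟨q, hq, p, hp, sandwich q p (otherInf s q) (otherInf t p) A, fun x hx y hy => ?_, ?_,
    fun c hc x hx hcx => h.sandwich_torsionfree_left hs hq hc hx hcx,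
    fun c hc x hx hxc => h.sandwich_torsionfree_right ht hp hc hx hxc⟩
  · refine mem_sandwich.2 ⟨(TwoSidedIdeal.mem_inf R).2 ⟨TwoSidedIdeal.mul_mem_right _ _ _ hx,
      TwoSidedIdeal.mul_mem_left _ _ _ hy⟩, fun n hn m hm => ?_⟩
    rw [← mul_assoc, mul_assoc]
    exact h.mul_mem _ (mem_finsetInf_of_mem_otherInf (TwoSidedIdeal.mul_mem_right _ _ _ hn)
      (TwoSidedIdeal.mul_mem_left _ _ _ hx)) _ (mem_finsetInf_of_mem_otherInf
      (TwoSidedIdeal.mul_mem_left _ _ _ hm) (TwoSidedIdeal.mul_mem_right _ _ _ hy))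
  · refine SetLike.lt_iff_le_and_exists.2 ⟨fun x hx => (mem_sandwich.1 hx).1, b, ?_, fun hb'' =>
      hqp ((mem_sandwich.1 hb'').2 _ (hu q hq).1 _ (hw p hp).1)⟩
    exact (TwoSidedIdeal.mem_inf R).2
      ⟨mem_finsetInf.1 hb'.1 q hq, mem_finsetInf.1 hb'.2 p hp⟩

end Link

/-! ### The action of `σ` on ideals, and orbits of semistable primes. -/

section Automorphism

variable {R : Type*} [Ring R]

theorem mem_image {σ : RingAut R} {I : TwoSidedIdeal R} {x : R} :
    x ∈ image σ I ↔ σ.symm x ∈ I :=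
  TwoSidedIdeal.mem_comap _

theorem apply_mem_image {σ : RingAut R} {I : TwoSidedIdeal R} {x : R} :
    σ x ∈ image σ I ↔ x ∈ I := by
  rw [mem_image, RingEquiv.symm_apply_apply]

theorem image_one (I : TwoSidedIdeal R) : image 1 I = I :=
  TwoSidedIdeal.ext fun _ => apply_mem_image (σ := 1)

theorem image_mul (σ τ : RingAut R) (I : TwoSidedIdeal R) :
    image (σ * τ) I = image σ (image τ I) := by
  ext x
  simp only [mem_image]
  rfl

theorem image_le_image {σ : RingAut R} {I J : TwoSidedIdeal R} :
    image σ I ≤ image σ J ↔ I ≤ J :=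
  (RingEquiv.mapTwoSidedIdeal σ).le_iff_le

theorem image_injective (σ : RingAut R) : Function.Injective (image σ) :=
  (RingEquiv.mapTwoSidedIdeal σ).injective

theorem image_symm_image (σ : RingAut R) (I : TwoSidedIdeal R) : image σ (image σ⁻¹ I) = I := by
  rw [← image_mul, mul_inv_cancel, image_one]

theorem IsPrimeIdeal.image {Q : TwoSidedIdeal R} (hQ : IsPrimeIdeal Q) (σ : RingAut R) :
    IsPrimeIdeal (image σ Q) where
  ne_top h := hQ.ne_top (image_injective σ (h.trans (map_top σ.mapTwoSidedIdeal).symm))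
  le_or_le I J h := by
    rw [← image_symm_image σ I, ← image_symm_image σ J, image_le_image, image_le_image]
    refine hQ.le_or_le _ _ fun x hx y hy => ?_
    rw [← apply_mem_image (σ := σ), map_mul]
    refine h _ ?_ _ ?_
    · rwa [← image_symm_image σ I, apply_mem_image]
    · rwa [← image_symm_image σ J, apply_mem_image]

theorem IsRegularMod.of_image {σ : RingAut R} {I : TwoSidedIdeal R} {c : R}
    (h : IsRegularMod (image σ I) c) : IsRegularMod I (σ.symm c) := fun r => by
  have := h (σ r)
  simpa only [mem_image, map_mul, RingEquiv.symm_apply_apply] using this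

theorem IsLinked.image {Q P : TwoSidedIdeal R} (h : IsLinked Q P) (σ : RingAut R) :
    IsLinked (image σ Q) (image σ P) := by
  obtain ⟨A, hA⟩ := h
  refine ⟨NoetherianLinks.image σ A, fun x hx y hy => ?_, ?_, fun c hc x hx hcx => ?_,
    fun c hc x hx hxc => ?_⟩
  · rw [mem_image] at *
    rw [map_mul]
    exact hA.mul_mem _ hx _ hy
  · have := (RingEquiv.mapTwoSidedIdeal σ).lt_iff_lt.2 hA.lt_inf
    rwa [map_inf] at this
  · rw [TwoSidedIdeal.mem_inf, mem_image, mem_image] at hx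
    rw [mem_image] at hcx ⊢
    rw [map_mul] at hcx
    exact hA.torsionfree_left _ hc.of_image _ ((TwoSidedIdeal.mem_inf R).2 hx) hcx
  · rw [TwoSidedIdeal.mem_inf, mem_image, mem_image] at hx
    rw [mem_image] at hxc ⊢
    rw [map_mul] at hxc
    exact hA.torsionfree_right _ hc.of_image _ ((TwoSidedIdeal.mem_inf R).2 hx) hxc

theorem IsInvariant.pow {σ : RingAut R} {I : TwoSidedIdeal R} (h : IsInvariant σ I) (k : ℕ) :
    image (σ ^ k) I = I := by
  induction k with
  | zero => rw [pow_zero, image_one]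
  | succ k ih => rw [pow_succ, image_mul, h, ih]

theorem image_pow_mul {σ : RingAut R} {Q : TwoSidedIdeal R} {n : ℕ} (h : image (σ ^ n) Q = Q)
    (k : ℕ) : image (σ ^ (n * k)) Q = Q := by
  rw [pow_mul]
  exact IsInvariant.pow h k

theorem image_pow_mod {σ : RingAut R} {Q : TwoSidedIdeal R} {n : ℕ} (h : image (σ ^ n) Q = Q)
    (k : ℕ) : image (σ ^ (k % n)) Q = image (σ ^ k) Q := by
  conv_rhs => rw [← Nat.mod_add_div k n, pow_add, image_mul, image_pow_mul h]

open Classical in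
/-- The ideals `σ^k(Q)` for `k < n`. -/
noncomputable def orbit (σ : RingAut R) (Q : TwoSidedIdeal R) (n : ℕ) :
    Finset (TwoSidedIdeal R) :=
  (Finset.range n).image fun k => image (σ ^ k) Q

theorem mem_orbit {σ : RingAut R} {Q I : TwoSidedIdeal R} {n : ℕ} :
    I ∈ orbit σ Q n ↔ ∃ k < n, image (σ ^ k) Q = I := by
  simp [orbit]

theorem invariantPart_eq_finsetInf_orbit {σ : RingAut R} {Q : TwoSidedIdeal R} {n : ℕ}
    (hn : 1 ≤ n) (h : image (σ ^ n) Q = Q) : invariantPart σ Q = (orbit σ Q n).inf id := by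
  refine (isGreatest_invariantPart σ Q).unique ⟨⟨?_, ?_⟩, fun J hJ => ?_⟩
  · ext x
    rw [mem_image, mem_finsetInf, mem_finsetInf]
    have key : ∀ k, image (σ ^ k) Q ∈ orbit σ Q n := fun k =>
      mem_orbit.2 ⟨k % n, Nat.mod_lt _ hn, image_pow_mod h k⟩
    constructor
    · intro hx q hq
      obtain ⟨k, -, rfl⟩ := mem_orbit.1 hq
      -- On the orbit, `σ ^ (n - 1)` acts as `σ⁻¹`.
      have := hx _ (key (k + (n - 1)))
      rw [← mem_image, ← image_mul, ← pow_succ', show k + (n - 1) + 1 = k + n by omega, pow_add,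
        image_mul, h] at this
      exact this
    · intro hx q hq
      obtain ⟨k, -, rfl⟩ := mem_orbit.1 hq
      rw [← mem_image, ← image_mul, ← pow_succ']
      exact hx _ (key (k + 1))
  · intro x hx
    have := mem_finsetInf.1 hx _ (mem_orbit.2 ⟨0, hn, rfl⟩)
    rwa [pow_zero, image_one] at this
  · intro x hx
    refine mem_finsetInf.2 fun q hq => ?_
    obtain ⟨k, -, rfl⟩ := mem_orbit.1 hq
    have hJk := IsInvariant.pow hJ.1 k
    exact image_le_image.2 hJ.2 (hJk.symm ▸ hx)

/-- The chain `Q ⊇ σ^k(Q) ⊇ σ^(2k)(Q) ⊇ ...` is back at `Q` after `n` steps, so it is constant. -/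
theorem image_pow_eq_of_le {σ : RingAut R} {Q : TwoSidedIdeal R} {n : ℕ} (hn : 1 ≤ n)
    (h : image (σ ^ n) Q = Q) {k : ℕ} (hk : image (σ ^ k) Q ≤ Q) : image (σ ^ k) Q = Q := by
  refine le_antisymm hk ?_
  have hle : ∀ m : ℕ, 1 ≤ m → image ((σ ^ k) ^ m) Q ≤ image (σ ^ k) Q := by
    intro m hm
    induction m, hm using Nat.le_induction with
    | base => rw [pow_one]
    | succ m _ ih =>
      rw [pow_succ', image_mul]
      exact image_le_image.2 (ih.trans hk)
  calc Q = image ((σ ^ k) ^ n) Q := by rw [← pow_mul, mul_comm, image_pow_mul h]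
    _ ≤ _ := hle n hn

theorem isPrimeAntichain_orbit {σ : RingAut R} {Q : TwoSidedIdeal R} (hQ : IsPrimeIdeal Q) {n : ℕ}
    (hn : 1 ≤ n) (h : image (σ ^ n) Q = Q) : IsPrimeAntichain (orbit σ Q n) where
  isPrimeIdeal q hq := by
    obtain ⟨k, -, rfl⟩ := mem_orbit.1 hq
    exact hQ.image _
  eq_of_le q hq q' hq' hle := by
    obtain ⟨k, -, rfl⟩ := mem_orbit.1 hq
    obtain ⟨l, hl, rfl⟩ := mem_orbit.1 hq'
    -- Applying `σ ^ (n - l)` moves the larger ideal to `Q`, which reduces to `image_pow_eq_of_le`.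
    have hl' : image (σ ^ (n - l)) (image (σ ^ l) Q) = Q := by
      rw [← image_mul, ← pow_add, Nat.sub_add_cancel hl.le, h]
    refine image_injective (σ ^ (n - l)) ?_
    rw [← image_le_image (σ := σ ^ (n - l)), hl', ← image_mul, ← pow_add] at hle
    rw [hl', ← image_mul, ← pow_add]
    exact image_pow_eq_of_le hn h hle

end Automorphism

end NoetherianLinks

theorem mainTheorem2 {R : Type*} [Ring R] [IsNoetherianRing R] [IsNoetherianRing Rᵐᵒᵖ]
    (σ : RingAut R) (Q P : TwoSidedIdeal R)
    (hQ : NoetherianLinks.IsPrimeIdeal Q) (hP : NoetherianLinks.IsPrimeIdeal P)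
    (hQσ : NoetherianLinks.IsSemistable σ Q) (hPσ : NoetherianLinks.IsSemistable σ P)
    (hlink : NoetherianLinks.IsLinked (NoetherianLinks.invariantPart σ Q)
      (NoetherianLinks.invariantPart σ P)) :
    ∀ i : ℕ, ∃ j : ℕ,
      NoetherianLinks.IsLinked (NoetherianLinks.image (σ ^ i) Q)
        (NoetherianLinks.image (σ ^ j) P) := by
  intro i
  obtain ⟨n, hn, hQn⟩ := hQσ
  obtain ⟨m, hm, hPm⟩ := hPσ
  rw [NoetherianLinks.invariantPart_eq_finsetInf_orbit hn hQn,
    NoetherianLinks.invariantPart_eq_finsetInf_orbit hm hPm] at hlink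
  obtain ⟨q, hq, p, hp, hqp⟩ := hlink.exists_isLinked_of_finsetInf
    (NoetherianLinks.isPrimeAntichain_orbit hQ hn hQn)
    (NoetherianLinks.isPrimeAntichain_orbit hP hm hPm)
  obtain ⟨k, hk, rfl⟩ := NoetherianLinks.mem_orbit.1 hq
  obtain ⟨l, -, rfl⟩ := NoetherianLinks.mem_orbit.1 hp
  -- As `k < n`, the power `σ ^ (i + (n - k))` takes `σ^k(Q)` to `σ^(i+n)(Q) = σ^i(Q)`.
  refine ⟨i + (n - k) + l, ?_⟩
  have := hqp.image (σ ^ (i + (n - k)))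
  rwa [← NoetherianLinks.image_mul, ← NoetherianLinks.image_mul, ← pow_add, ← pow_add,
    show i + (n - k) + k = i + n by omega, pow_add σ i n, NoetherianLinks.image_mul, hQn] at this
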